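/- \textbf{Ergodic Lemma.} Let $(X,d)$ be a nonempty compact metric space, let $m\ge 1$ and $n\ge 1$ be integers, and give $X^m$ the maximum metric. Let $\mathcal S=(X,(\phi_j)_{0\le j<n},(p_j)_{0\le j<n})$ consist of continuous maps $\phi_j:X^m\to X$ and continuous weights $p_j:X^m\to[0,1]$ with $\sum_{j}p_j(x)=1$ for every $x\in X^m$. Assume: (E1) for each $j$ there are $a_{j,0},\dots,a_{j,m-1}>0$ with $\sum_i a_{j,i}<1$ and $d(\phi_j(x),\phi_j(y))\le\sum_{i}a_{j,i}\,d(x_i,y_i)$ for all $x,y\in X^m$; (E2) there is $\delta>0$ with $p_j(x)\ge\delta$ for all $j$ and $x$, and for each $j$ there are $c_{j,0},\dots,c_{j,m-1}>0$ with $\sum_i c_{j,i}<1$ and $|p_j(x)-p_j(y)|\le\sum_i c_{j,i}\,d(x_i,y_i)$ for all $x,y\in X^m$. Let $\hat\phi_j(x_0,\dots,x_{m-1})=(x_1,\dots,x_{m-1},\phi_j(x_0,\dots,x_{m-1}))$, and let $\mathcal L$ be the Markov operator on Borel probability measures on $X^m$ given by $\int g\,d\mathcal L(\alpha)=\int\sum_j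 p_j(x)\,g(\hat\phi_j(x))\,d\alpha(x)$ for all $g\in C(X^m,\mathbb R)$. For $x=(x_0,\dots,x_{m-1})\in X^m$ and $w\in\Omega=\{0,\dots,n-1\}^{\mathbb N}$, the orbit is defined by $x_j(w)=x_j$ for $0\le j<m$ and $x_{j+m}(w)=\phi_{w_j}(x_j(w),\dots,x_{j+m-1}(w))$ for $j\ge0$. Let $P_x$ be the Borel probability measure on $\Omega$ whose value on the cylinder of sequences beginning with $w_0\cdots w_{k-1}$ is $\prod_{i=0}^{k-1}p_{w_i}(x_i(w),\dots,x_{i+m-1}(w))$. Then $\mathcal L$ has exactly one fixed point $\alpha$ (the extended Hutchinson measure), and for each $x\in X^m$ there is a measurable set $\Omega_x\subseteq\Omega$ with $P_x(\Omega_x)=1$ such that for every $w\in\Omega_x$ and every $g\in C(X^m,\mathbb R)$ $$\frac1N\sum_{k=0}^{N-1}g\big(x_{mk}(w),x_{mk+1}(w),\dots,x_{mk+m-1}(w)\big)\longrightarrow\int_{X^m}g\,d\alpha\qquad(N\to\infty).$$ -/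

import Mathlib

open MeasureTheory ProbabilityTheory Filter Topology

/-- A generalized iterated function system with place dependent probabilities, of degree `m` with
`n` maps: continuous maps `φ j : X^m → X` and continuous weights `p j : X^m → [0,1]` with sum `1`.
The space `X^m` is `Fin m → X`, with the maximum metric. -/
structure GIFSpdp (X : Type*) [TopologicalSpace X] (m n : ℕ) where
  φ : Fin n → (Fin m → X) → X
  p : Fin n → (Fin m → X) → ℝ
  continuous_φ : ∀ j, Continuous (φ j)
  continuous_p : ∀ j, Continuous (p j)
  p_mem : ∀ j x, p j x ∈ Set.Icc (0 : ℝ) 1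
  sum_p : ∀ x, ∑ j, p j x = 1

/-- The class `Lip_{a_0, …, a_{m-1}}(X^m, Y)`. -/
def LipCoeff {X Y : Type*} [PseudoMetricSpace X] [PseudoMetricSpace Y] {m : ℕ}
    (a : Fin m → ℝ) (f : (Fin m → X) → Y) : Prop :=
  (∀ i, 0 < a i) ∧ ∀ x y, dist (f x) (f y) ≤ ∑ i, a i * dist (x i) (y i)

namespace GIFSpdp

section Metric

variable {X : Type*} [MetricSpace X] {m n : ℕ}

/-- Hypothesis E1: each map is in some `Lip_{a}` with total coefficient `< 1`. -/
def E1 (S : GIFSpdp X m n) : Prop :=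
  ∀ j, ∃ a : Fin m → ℝ, LipCoeff a (S.φ j) ∧ ∑ i, a i < 1

/-- Hypothesis E2: the weights are bounded below by a positive constant, and each of them is in
some `Lip_{c}` with total coefficient `< 1`. -/
def E2 (S : GIFSpdp X m n) : Prop :=
  (∃ δ : ℝ, 0 < δ ∧ ∀ j x, δ ≤ S.p j x) ∧
    ∀ j, ∃ c : Fin m → ℝ, LipCoeff c (S.p j) ∧ ∑ i, c i < 1

end Metric

section Dynamics

variable {X : Type*} [TopologicalSpace X] {m n : ℕ}

/-- The maps of the extension: `(x_0, …, x_{m-1}) ↦ (x_1, …, x_{m-1}, φ_j(x_0, …, x_{m-1}))`. -/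
def ext (S : GIFSpdp X m n) (j : Fin n) (x : Fin m → X) : Fin m → X :=
  fun k => if h : (k : ℕ) + 1 < m then x ⟨k + 1, h⟩ else S.φ j x

theorem continuous_ext (S : GIFSpdp X m n) (j : Fin n) : Continuous (S.ext j) := by
  refine continuous_pi fun k => ?_
  unfold ext
  split_ifs with h
  · exact continuous_apply _
  · exact S.continuous_φ j

/-- The orbit `x_0, x_1, …` of the system: the first `m` terms are the given starting points and
`x_{j+m} = φ_{w_j}(x_j, …, x_{j+m-1})`. -/
def orbit (S : GIFSpdp X m n) (x : Fin m → X) (w : ℕ → Fin n) (j : ℕ) : X :=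
  if h : j < m then x ⟨j, h⟩
  else S.φ (w (j - m)) (fun i : Fin m => orbit S x w (j - m + i))
termination_by j
decreasing_by omega

/-- The block `(x_k, …, x_{k+m-1})` of the orbit. -/
def block (S : GIFSpdp X m n) (x : Fin m → X) (w : ℕ → Fin n) (k : ℕ) : Fin m → X :=
  fun i => S.orbit x w (k + i)

theorem block_zero (S : GIFSpdp X m n) (x : Fin m → X) (w : ℕ → Fin n) : S.block x w 0 = x := by
  funext i
  simp [block, orbit]

/-- The blocks of the orbit form the orbit of the extension. -/
theorem block_succ (S : GIFSpdp X m n) (x : Fin m → X) (w : ℕ → Fin n) (k : ℕ) :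
    S.block x w (k + 1) = S.ext (w k) (S.block x w k) := by
  funext i
  unfold block ext
  split_ifs with h
  · congr 1
    simp only
    omega
  · have e : k + 1 + (i : ℕ) = k + m := by omega
    rw [e, orbit]
    simp

theorem block_congr (S : GIFSpdp X m n) (x : Fin m → X) {w w' : ℕ → Fin n} {k : ℕ}
    (h : ∀ i < k, w i = w' i) : S.block x w k = S.block x w' k := by
  induction k with
  | zero => simp [block_zero]
  | succ k ih =>
    rw [block_succ, block_succ, ih fun i hi => h i (by omega), h k (by omega)]

/-- The law on the symbols that gives `j` the probability `p_j(x)`. -/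
noncomputable def symbolLaw (S : GIFSpdp X m n) (x : Fin m → X) : Measure (Fin n) :=
  ∑ j, ENNReal.ofReal (S.p j x) • Measure.dirac j

theorem symbolLaw_singleton (S : GIFSpdp X m n) (x : Fin m → X) (j : Fin n) :
    S.symbolLaw x {j} = ENNReal.ofReal (S.p j x) := by
  simp [symbolLaw, Measure.finsetSum_apply, Set.indicator_apply]

instance (S : GIFSpdp X m n) (x : Fin m → X) : IsProbabilityMeasure (S.symbolLaw x) := by
  constructor
  simp only [symbolLaw, Measure.finsetSum_apply, Measure.smul_apply, measure_univ, smul_eq_mul,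
    mul_one]
  rw [← ENNReal.ofReal_sum_of_nonneg fun j _ => (S.p_mem j x).1, S.sum_p, ENNReal.ofReal_one]

/-- A finite word `w_0 … w_k` prolonged to an infinite one (the added letters are irrelevant). -/
def prolong {k : ℕ} (w : Finset.Iic k → Fin n) (i : ℕ) : Fin n :=
  if h : i ≤ k then w ⟨i, Finset.mem_Iic.2 h⟩ else w ⟨0, Finset.mem_Iic.2 (Nat.zero_le k)⟩

/-- The law of the symbol `w_{k+1}` given `w_0, …, w_k`: the symbol `j` has probability
`p_j(x_{k+1}, …, x_{k+m})`, where the point on the right is determined by `w_0, …, w_k`. -/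
noncomputable def step (S : GIFSpdp X m n) (x : Fin m → X) (k : ℕ) :
    Kernel (Finset.Iic k → Fin n) (Fin n) :=
  Kernel.ofFunOfCountable fun w => S.symbolLaw (S.block x (prolong w) (k + 1))

instance (S : GIFSpdp X m n) (x : Fin m → X) (k : ℕ) : IsMarkovKernel (S.step x k) :=
  ⟨fun w => inferInstanceAs
    (IsProbabilityMeasure (S.symbolLaw (S.block x (prolong w) (k + 1))))⟩

/-- The path measure `P_x` on `Ω = {0, …, n-1}^ℕ`, built from its successive conditional laws;
`pathMeasure_cylinder` gives its values on cylinders. -/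
noncomputable def pathMeasure (S : GIFSpdp X m n) (x : Fin m → X) : Measure (ℕ → Fin n) :=
  Kernel.trajMeasure (X := fun _ => Fin n) (S.symbolLaw x) (S.step x)

instance (S : GIFSpdp X m n) (x : Fin m → X) : IsProbabilityMeasure (S.pathMeasure x) := by
  unfold pathMeasure
  infer_instance

/-- The cylinder of the words that agree with `w` at the places `0, …, k-1`. -/
def cylinder (w : ℕ → Fin n) (k : ℕ) : Set (ℕ → Fin n) := {v | ∀ i < k, v i = w i}

theorem pathMeasure_cylinder (S : GIFSpdp X m n) (x : Fin m → X) (w : ℕ → Fin n) (k : ℕ) :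
    S.pathMeasure x (cylinder w k) =
      ∏ i ∈ Finset.range k, ENNReal.ofReal (S.p (w i) (S.block x w i)) := by
  have hcyl : ∀ a, cylinder w (a + 1) = Preorder.frestrictLe (π := fun _ => Fin n) a ⁻¹'
      {Preorder.frestrictLe (π := fun _ => Fin n) a w} := by
    intro a
    ext v
    simp [cylinder, funext_iff]
  have hmeas : ∀ a, Measurable (Preorder.frestrictLe (π := fun _ : ℕ => Fin n) a) :=
    fun a => Preorder.measurable_frestrictLe a
  induction k with
  | zero => simp [cylinder]
  | succ k ih =>
    rw [Finset.prod_range_succ, ← ih]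
    cases k with
    | zero =>
      have h0 : cylinder w 0 = Set.univ := by simp [cylinder]
      rw [h0, measure_univ, one_mul, block_zero, hcyl, ← Measure.map_apply (hmeas 0) (by measurability)]
      unfold pathMeasure Kernel.trajMeasure
      rw [Measure.map_comp _ _ (hmeas 0), Kernel.traj_map_frestrictLe, Kernel.partialTraj_self,
        Measure.id_comp, Measure.map_apply (by fun_prop) (by measurability), ← symbolLaw_singleton]
      congr 1
      ext v
      simp [funext_iff]
    | succ a =>
      have key := Kernel.map_frestrictLe_trajMeasure_compProd_eq_map_trajMeasure
        (X := fun _ => Fin n) (μ₀ := S.symbolLaw x) (κ := S.step x) (a := a)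
      have e : cylinder w (a + 1 + 1) = (fun v : ℕ → Fin n =>
          (Preorder.frestrictLe (π := fun _ => Fin n) a v, v (a + 1))) ⁻¹'
          ({Preorder.frestrictLe (π := fun _ => Fin n) a w} ×ˢ {w (a + 1)}) := by
        ext v
        simp only [cylinder, Set.mem_ofPred_eq, Set.mem_preimage, Set.mem_prod,
          Set.mem_singleton_iff, funext_iff]
        constructor
        · intro h
          exact ⟨fun i => h i (by have := Finset.mem_Iic.1 i.2; omega), h _ (by omega)⟩
        · rintro ⟨h1, h2⟩ i hi
          rcases Nat.lt_succ_iff_lt_or_eq.1 hi with h | rfl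
          · exact h1 ⟨i, Finset.mem_Iic.2 (by omega)⟩
          · exact h2
      rw [e, ← Measure.map_apply ((hmeas a).prodMk (measurable_pi_apply _)) (by measurability)]
      unfold pathMeasure
      rw [← key, Measure.compProd_apply_prod (by measurability) (by measurability),
        lintegral_singleton, mul_comm, Measure.map_apply (hmeas a) (by measurability), ← hcyl]
      congr 1
      change S.symbolLaw _ _ = _
      rw [symbolLaw_singleton]
      congr 2
      apply block_congr
      intro i hi
      simp [prolong, Nat.lt_succ_iff.1 hi]

end Dynamics

section Markov

variable {X : Type*} [MetricSpace X] [CompactSpace X] {m n : ℕ}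

/-- The transfer operator of the extension, `B g (x) = ∑ j, p_j(x) g(ext_j(x))`. -/
def transfer (S : GIFSpdp X m n) (g : C(Fin m → X, ℝ)) : C(Fin m → X, ℝ) where
  toFun x := ∑ j, S.p j x * g (S.ext j x)
  continuous_toFun := continuous_finsetSum _ fun j _ =>
    (S.continuous_p j).mul (g.continuous.comp (S.continuous_ext j))

variable [MeasurableSpace X] [BorelSpace X]

/-- The Markov operator of the extension on measures; by `integral_markov` it is the dual of
`transfer`. -/
noncomputable def markovMeasure (S : GIFSpdp X m n) (α : Measure (Fin m → X)) :
    Measure (Fin m → X) :=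
  ∑ j, (α.withDensity fun x => ENNReal.ofReal (S.p j x)).map (S.ext j)

theorem isProbabilityMeasure_markovMeasure (S : GIFSpdp X m n) (α : Measure (Fin m → X))
    [IsProbabilityMeasure α] : IsProbabilityMeasure (S.markovMeasure α) := by
  constructor
  simp only [markovMeasure, Measure.finsetSum_apply]
  simp_rw [Measure.map_apply (S.continuous_ext _).measurable MeasurableSet.univ, Set.preimage_univ,
    withDensity_apply _ MeasurableSet.univ, Measure.restrict_univ]
  rw [← lintegral_finsetSum]
  · simp_rw [← ENNReal.ofReal_sum_of_nonneg fun j _ => (S.p_mem j _).1, S.sum_p]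
    simp
  · exact fun j _ => (S.continuous_p j).measurable.ennreal_ofReal

/-- The Markov operator of the extension on `Prob(X^m)`. -/
noncomputable def markov (S : GIFSpdp X m n) (α : ProbabilityMeasure (Fin m → X)) :
    ProbabilityMeasure (Fin m → X) :=
  ⟨S.markovMeasure (α : Measure (Fin m → X)),
    S.isProbabilityMeasure_markovMeasure (α : Measure (Fin m → X))⟩

theorem integral_markov (S : GIFSpdp X m n) (α : ProbabilityMeasure (Fin m → X))
    (g : C(Fin m → X, ℝ)) :
    ∫ x, g x ∂(S.markov α : Measure (Fin m → X)) = ∫ x, S.transfer g x ∂(α : Measure (Fin m → X)) := by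
  have hα : ∀ h : C(Fin m → X, ℝ), Integrable h (α : Measure (Fin m → X)) := fun h =>
    h.continuous.integrable_of_hasCompactSupport (HasCompactSupport.of_compactSpace h)
  have hP := S.isProbabilityMeasure_markovMeasure (α : Measure (Fin m → X))
  have hg : Integrable g (S.markovMeasure (α : Measure (Fin m → X))) :=
    g.continuous.integrable_of_hasCompactSupport (HasCompactSupport.of_compactSpace g)
  change ∫ x, g x ∂(S.markovMeasure (α : Measure (Fin m → X))) = _
  unfold markovMeasure at hg ⊢
  rw [integral_finsetSum_measure (integrable_finsetSum_measure.1 hg)]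
  have e : ∀ j, ∫ x, g x ∂(((α : Measure (Fin m → X)).withDensity
      fun x => ENNReal.ofReal (S.p j x)).map (S.ext j)) =
      ∫ x, S.p j x * g (S.ext j x) ∂(α : Measure (Fin m → X)) := by
    intro j
    rw [integral_map (S.continuous_ext j).measurable.aemeasurable
      g.continuous.aestronglyMeasurable,
      integral_withDensity_eq_integral_toReal_smul
        (S.continuous_p j).measurable.ennreal_ofReal (by simp)]
    simp [ENNReal.toReal_ofReal (S.p_mem j _).1]
  simp_rw [e]
  rw [← integral_finsetSum]
  · rfl
  · exact fun j _ => hα ⟨fun x => S.p j x * g (S.ext j x),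
      (S.continuous_p j).mul (g.continuous.comp (S.continuous_ext j))⟩

/-- `α` is the extended Hutchinson measure of `S`: the unique fixed point of the Markov operator
of the extension in `Prob(X^m)`. -/
def IsExtendedHutchinson (S : GIFSpdp X m n) (α : ProbabilityMeasure (Fin m → X)) : Prop :=
  S.markov α = α ∧ ∀ β : ProbabilityMeasure (Fin m → X), S.markov β = β → β = α

end Markov

end GIFSpdp

/-! The blocks of an orbit form a Markov chain on `X^m` with transition operator `T = transfer`, and
two facts about `T` carry the theorem.

The iterates `T^N g` converge uniformly to a constant (`exists_tendsto_iterate_transfer`). The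
extension maps need not contract the maximum metric, since they mostly shift coordinates, but they
do contract the distance that weights coordinate `i` by `θ ^ i`, for `θ > 1` close to `1`. With
Lipschitz weights `p_j`, this gives all iterates one approximate Lipschitz bound. Since `p_j ≥ δ`,
the operator `T^M` puts mass at least `δ ^ M` on the `M`-fold composition of a single map, which
brings any two points close together; comparing oscillations at times `N` and `N + M` forces the
limiting oscillation to vanish. Compactness of the space of probability measures yields a measure
whose integrals are these constants, and it is the only fixed point.

The differences `g(block at l(k+1)) - (T^l g)(block at lk)` are orthogonal by the Markov property,
hence obey a strong law (`ae_tendsto_average_sub_iterate_transfer`). Using this with `l = m` for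
each `T^(mr) g`, the averages of `g` may be replaced by those of `T^(mr) g`, which is uniformly
close to `∫ g dα` for large `r`. A countable dense set of functions `g` then provides one set of
full measure for all of them. -/

/-! ### Strong law for bounded orthogonal variables -/

/-- The second moment of a sum of bounded orthogonal random variables grows at most linearly. -/
theorem integral_sq_sum_le_of_orthogonal {Ω : Type*} [MeasurableSpace Ω] {μ : Measure Ω}
    [IsProbabilityMeasure μ] {Y : ℕ → Ω → ℝ} {C : ℝ} (hY : ∀ k, Measurable (Y k))
    (hC : ∀ k ω, |Y k ω| ≤ C) (horth : ∀ i j, i < j → ∫ ω, Y i ω * Y j ω ∂μ = 0) (N : ℕ) :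
    ∫ ω, (∑ k ∈ Finset.range N, Y k ω) ^ 2 ∂μ ≤ N * C ^ 2 := by
  have hYY : ∀ i j, Integrable (fun ω => Y i ω * Y j ω) μ := fun i j =>
    Integrable.of_bound ((hY i).mul (hY j)).aestronglyMeasurable (C * C) (ae_of_all _ fun ω => by
      rw [norm_mul, Real.norm_eq_abs, Real.norm_eq_abs]
      exact mul_le_mul (hC i ω) (hC j ω) (abs_nonneg _) ((abs_nonneg _).trans (hC i ω)))
  have hS : ∀ N, (fun ω => (∑ k ∈ Finset.range N, Y k ω) ^ 2) =
      fun ω => ∑ i ∈ Finset.range N, ∑ j ∈ Finset.range N, Y i ω * Y j ω := by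
    intro N
    funext ω
    rw [sq, Finset.sum_mul_sum]
  rw [hS, integral_finsetSum _ fun i _ => integrable_finsetSum _ fun j _ => hYY i j]
  have hrow : ∀ i ∈ Finset.range N,
      ∫ ω, ∑ j ∈ Finset.range N, Y i ω * Y j ω ∂μ ≤ C ^ 2 := by
    intro i hi
    rw [integral_finsetSum _ fun j _ => hYY i j, Finset.sum_eq_single_of_mem i hi]
    · calc ∫ ω, Y i ω * Y i ω ∂μ ≤ ∫ _, C ^ 2 ∂μ := by
            refine integral_mono (hYY i i) (integrable_const _) fun ω => ?_
            change Y i ω * Y i ω ≤ C ^ 2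
            rw [← sq]
            exact sq_le_sq' (abs_le.1 (hC i ω)).1 (abs_le.1 (hC i ω)).2
        _ = C ^ 2 := by simp
    · intro j _ hji
      rcases lt_or_gt_of_ne hji with h | h
      · simp_rw [mul_comm (Y i _)]
        exact horth j i h
      · exact horth i j h
  calc _ ≤ ∑ _i ∈ Finset.range N, C ^ 2 := Finset.sum_le_sum hrow
    _ = N * C ^ 2 := by simp

/-- Nonnegative integrable functions with summable integrals tend to zero almost everywhere. -/
theorem ae_tendsto_zero_of_summable_integral {Ω : Type*} [MeasurableSpace Ω] {μ : Measure Ω}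
    {F : ℕ → Ω → ℝ} (hF : ∀ k, Integrable (F k) μ) (hF0 : ∀ k ω, 0 ≤ F k ω)
    (hsum : Summable fun k => ∫ ω, F k ω ∂μ) :
    ∀ᵐ ω ∂μ, Tendsto (fun k => F k ω) atTop (𝓝 0) := by
  have hmeas : ∀ k, AEMeasurable (fun ω => ENNReal.ofReal (F k ω)) μ := fun k =>
    (hF k).aestronglyMeasurable.aemeasurable.ennreal_ofReal
  have hfin : ∫⁻ ω, ∑' k, ENNReal.ofReal (F k ω) ∂μ ≠ ⊤ := by
    rw [lintegral_tsum hmeas]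
    simp_rw [← ofReal_integral_eq_lintegral_ofReal (hF _) (ae_of_all _ (hF0 _))]
    exact hsum.tsum_ofReal_ne_top
  filter_upwards [ae_lt_top' (AEMeasurable.tsum hmeas) hfin] with ω hω
  have h := (ENNReal.tendsto_toReal ENNReal.zero_ne_top).comp
    (ENNReal.tendsto_atTop_zero_of_tsum_ne_top hω.ne)
  simpa [Function.comp_def, ENNReal.toReal_ofReal (hF0 _ ω)] using h

/-- If the averages of a bounded sequence tend to zero along the squares, they tend to zero. -/
theorem tendsto_average_of_tendsto_average_sq {y : ℕ → ℝ} {C : ℝ} (hC : ∀ k, |y k| ≤ C)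
    (h : Tendsto (fun N : ℕ => (∑ k ∈ Finset.range (N ^ 2), y k) / ((N ^ 2 : ℕ) : ℝ))
      atTop (𝓝 0)) :
    Tendsto (fun N : ℕ => (∑ k ∈ Finset.range N, y k) / (N : ℝ)) atTop (𝓝 0) := by
  -- Adding `C` makes the summands nonnegative, so that the partial sums are monotone and can be
  -- interpolated between consecutive squares.
  have hmono : Monotone fun N : ℕ => ∑ k ∈ Finset.range N, (y k + C) :=
    monotone_nat_of_le_succ fun N => by
      rw [Finset.sum_range_succ]
      linarith [(abs_le.1 (hC N)).1]
  have hsplit : ∀ N : ℕ, N ≠ 0 → (∑ k ∈ Finset.range N, (y k + C)) / (N : ℝ) =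
      (∑ k ∈ Finset.range N, y k) / (N : ℝ) + C := by
    intro N hN
    have : (N : ℝ) ≠ 0 := Nat.cast_ne_zero.2 hN
    rw [Finset.sum_add_distrib, Finset.sum_const, Finset.card_range, nsmul_eq_mul]
    field_simp
  have key := tendsto_div_of_monotone_of_exists_subseq_tendsto_div _ C hmono fun a ha => by
    refine ⟨fun N => N ^ 2, ?_, tendsto_pow_atTop two_ne_zero, ?_⟩
    -- Consecutive squares have ratio `(1 + 1/N)^2`, eventually below any `a > 1`.
    · have hlim : Tendsto (fun N : ℕ => (1 + 1 / (N : ℝ)) ^ 2) atTop (𝓝 ((1 + 0) ^ 2)) :=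
        (tendsto_one_div_atTop_nhds_zero_nat.const_add 1).pow 2
      have hlt : ((1 : ℝ) + 0) ^ 2 < a := by simpa using ha
      filter_upwards [hlim.eventually_lt_const hlt, eventually_ge_atTop 1] with N hN hN1
      have hpos : (0 : ℝ) < N := by exact_mod_cast hN1
      have e : ((N + 1 : ℕ) ^ 2 : ℝ) = (1 + 1 / (N : ℝ)) ^ 2 * (N : ℝ) ^ 2 := by
        push_cast
        field_simp
      push_cast at e ⊢
      rw [e]
      exact mul_le_mul_of_nonneg_right hN.le (by positivity)
    · have h' := h.add_const C
      rw [zero_add] at h'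
      refine h'.congr' ?_
      filter_upwards [eventually_ge_atTop 1] with N hN
      exact (hsplit _ (by positivity)).symm
  have key' := key.sub_const C
  rw [sub_self] at key'
  refine key'.congr' ?_
  filter_upwards [eventually_ge_atTop 1] with N hN
  rw [hsplit N (by omega), add_sub_cancel_right]

/-- The strong law of large numbers for bounded orthogonal random variables. -/
theorem ae_tendsto_average_of_orthogonal {Ω : Type*} [MeasurableSpace Ω] {μ : Measure Ω}
    [IsProbabilityMeasure μ] {Y : ℕ → Ω → ℝ} {C : ℝ} (hY : ∀ k, Measurable (Y k))
    (hC : ∀ k ω, |Y k ω| ≤ C) (horth : ∀ i j, i < j → ∫ ω, Y i ω * Y j ω ∂μ = 0) :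
    ∀ᵐ ω ∂μ, Tendsto (fun N : ℕ => (∑ k ∈ Finset.range N, Y k ω) / (N : ℝ)) atTop (𝓝 0) := by
  have hint : ∀ N, Integrable (fun ω => (∑ k ∈ Finset.range N, Y k ω) ^ 2) μ := fun N =>
    Integrable.of_bound
      ((Finset.measurable_fun_sum _ fun k _ => hY k).pow_const 2).aestronglyMeasurable
      ((∑ _k ∈ Finset.range N, C) ^ 2) (ae_of_all _ fun ω => by
        rw [norm_pow, Real.norm_eq_abs]
        refine pow_le_pow_left₀ (abs_nonneg _) ?_ 2
        exact (Finset.abs_sum_le_sum_abs _ _).trans (Finset.sum_le_sum fun k _ => hC k ω))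
  have hsq : ∀ᵐ ω ∂μ, Tendsto (fun N : ℕ =>
      ((∑ k ∈ Finset.range (N ^ 2), Y k ω) / ((N ^ 2 : ℕ) : ℝ)) ^ 2) atTop (𝓝 0) := by
    refine ae_tendsto_zero_of_summable_integral (fun N => ?_) (fun N ω => sq_nonneg _) ?_
    · simp_rw [div_pow]
      exact (hint _).div_const _
    -- Over `N ^ 2` terms the average has second moment at most `C ^ 2 / N ^ 2`, which is summable;
    -- along all integers the bound would only be `C ^ 2 / N`.
    · refine Summable.of_nonneg_of_le (fun N => integral_nonneg fun ω => sq_nonneg _)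
        (fun N => ?_) ((Real.summable_one_div_nat_pow.2 one_lt_two).mul_right (C ^ 2))
      simp_rw [div_pow]
      rw [integral_div]
      rcases Nat.eq_zero_or_pos N with rfl | hN
      · simp
      · have hpos : (0 : ℝ) < N := by exact_mod_cast hN
        rw [div_le_iff₀ (by positivity)]
        refine (integral_sq_sum_le_of_orthogonal hY hC horth (N ^ 2)).trans (le_of_eq ?_)
        push_cast
        field_simp
  filter_upwards [hsq] with ω hω
  refine tendsto_average_of_tendsto_average_sq (fun k => hC k ω) ?_
  have h := hω.sqrt
  simp only [Real.sqrt_sq_eq_abs, Real.sqrt_zero] at h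
  exact (tendsto_zero_iff_abs_tendsto_zero _).2 h

namespace GIFSpdp

/-! ### Functions of finitely many letters -/

section Words

variable {n : ℕ}

/-- A finite word followed by the constant letter `j₀`. -/
def padWord (j₀ : Fin n) {k : ℕ} (v : Fin k → Fin n) (i : ℕ) : Fin n :=
  if h : i < k then v ⟨i, h⟩ else j₀

/-- A function of a sequence of letters depends only on the first `k` letters. -/
def DependsOnFirst (k : ℕ) (G : (ℕ → Fin n) → ℝ) : Prop :=
  ∀ w w' : ℕ → Fin n, (∀ i < k, w i = w' i) → G w = G w'

theorem DependsOnFirst.mono {k l : ℕ} {G : (ℕ → Fin n) → ℝ} (hG : DependsOnFirst k G)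
    (hkl : k ≤ l) : DependsOnFirst l G :=
  fun w w' h => hG w w' fun i hi => h i (hi.trans_le hkl)

theorem DependsOnFirst.eq_comp {k : ℕ} {G : (ℕ → Fin n) → ℝ} (hG : DependsOnFirst k G)
    (j₀ : Fin n) : G = (fun v : Fin k → Fin n => G (padWord j₀ v)) ∘ fun w i => w i := by
  funext w
  exact hG _ _ fun i hi => by simp [padWord, hi]

theorem DependsOnFirst.measurable {k : ℕ} {G : (ℕ → Fin n) → ℝ} (hG : DependsOnFirst k G) :
    Measurable G := by
  rcases isEmpty_or_nonempty (Fin n) with h | ⟨⟨j₀⟩⟩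
  · exact measurable_of_empty G
  · rw [hG.eq_comp j₀]
    exact (Measurable.of_discrete).comp (measurable_pi_lambda _ fun i => measurable_pi_apply _)

theorem DependsOnFirst.mul {k : ℕ} {G H : (ℕ → Fin n) → ℝ} (hG : DependsOnFirst k G)
    (hH : DependsOnFirst k H) : DependsOnFirst k fun w => G w * H w :=
  fun w w' h => congrArg₂ _ (hG w w' h) (hH w w' h)

theorem DependsOnFirst.sub {k : ℕ} {G H : (ℕ → Fin n) → ℝ} (hG : DependsOnFirst k G)
    (hH : DependsOnFirst k H) : DependsOnFirst k fun w => G w - H w :=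
  fun w w' h => congrArg₂ _ (hG w w' h) (hH w w' h)

theorem DependsOnFirst.integrable {k : ℕ} {G : (ℕ → Fin n) → ℝ} (hG : DependsOnFirst k G)
    (μ : Measure (ℕ → Fin n)) [IsProbabilityMeasure μ] : Integrable G μ := by
  obtain ⟨w⟩ := nonempty_of_isProbabilityMeasure μ
  have e := hG.eq_comp (w 0)
  rw [e]
  refine Integrable.of_bound (e ▸ hG.measurable).aestronglyMeasurable
    (∑ v : Fin k → Fin n, ‖G (padWord (w 0) v)‖) (ae_of_all _ fun u => ?_)
  exact Finset.single_le_sum (f := fun v : Fin k → Fin n => ‖G (padWord (w 0) v)‖)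
    (fun _ _ => norm_nonneg _) (Finset.mem_univ _)

end Words

/-! ### Path integrals as finite sums and the Markov property -/

section PathIntegral

variable {X : Type*} [TopologicalSpace X] {m n : ℕ}

theorem dependsOnFirst_block (S : GIFSpdp X m n) (x : Fin m → X) (h : (Fin m → X) → ℝ) (k : ℕ) :
    DependsOnFirst k fun w => h (S.block x w k) :=
  fun _ _ hw => congrArg h (S.block_congr x hw)

/-- The integral of a function of the first `k` letters is a finite sum over words. -/
theorem integral_pathMeasure (S : GIFSpdp X m n) (x : Fin m → X) {k : ℕ}
    {G : (ℕ → Fin n) → ℝ} (hG : DependsOnFirst k G) (j₀ : Fin n) :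
    ∫ w, G w ∂S.pathMeasure x = ∑ v : Fin k → Fin n,
      (∏ i ∈ Finset.range k, S.p (padWord j₀ v i) (S.block x (padWord j₀ v) i)) *
        G (padWord j₀ v) := by
  have hπ : Measurable fun (w : ℕ → Fin n) (i : Fin k) => w i :=
    measurable_pi_lambda _ fun i => measurable_pi_apply _
  have := Measure.isProbabilityMeasure_map (μ := S.pathMeasure x) hπ.aemeasurable
  conv_lhs => rw [hG.eq_comp j₀]
  simp only [Function.comp_def]
  rw [← integral_map (μ := S.pathMeasure x) hπ.aemeasurable
    (f := fun v : Fin k → Fin n => G (padWord j₀ v))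
    Measurable.of_discrete.aestronglyMeasurable, integral_fintype Integrable.of_finite]
  refine Finset.sum_congr rfl fun v _ => ?_
  rw [smul_eq_mul]
  congr 1
  rw [measureReal_def, Measure.map_apply hπ (MeasurableSet.singleton v)]
  have e : (fun (w : ℕ → Fin n) (i : Fin k) => w i) ⁻¹' {v} = cylinder (padWord j₀ v) k := by
    ext w
    simp only [Set.mem_preimage, Set.mem_singleton_iff, funext_iff, cylinder, Set.mem_ofPred_eq]
    exact ⟨fun h i hi => by simpa [padWord, hi] using h ⟨i, hi⟩,
      fun h i => by simpa [padWord] using h i i.2⟩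
  rw [e, pathMeasure_cylinder, ENNReal.toReal_prod]
  exact Finset.prod_congr rfl fun i _ => ENNReal.toReal_ofReal (S.p_mem _ _).1

/-- The Markov property of the blocks under the path measure. -/
theorem integral_mul_block_succ (S : GIFSpdp X m n) (x : Fin m → X) {k : ℕ}
    {F : (ℕ → Fin n) → ℝ} (hF : DependsOnFirst k F) (h : (Fin m → X) → ℝ) :
    ∫ w, F w * h (S.block x w (k + 1)) ∂S.pathMeasure x =
      ∫ w, F w * ∑ j, S.p j (S.block x w k) * h (S.ext j (S.block x w k))
        ∂S.pathMeasure x := by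
  obtain ⟨w₀⟩ := nonempty_of_isProbabilityMeasure (S.pathMeasure x)
  have j₀ := w₀ 0
  rw [S.integral_pathMeasure x ((hF.mono k.le_succ).mul (S.dependsOnFirst_block x h (k + 1))) j₀,
    S.integral_pathMeasure x (hF.mul (S.dependsOnFirst_block x
      (fun y => ∑ j, S.p j y * h (S.ext j y)) k)) j₀,
    -- A word of length `k + 1` is split into its first `k` letters and its last one; summing over
    -- the last letter produces the one-step expectation.
    ← (Fin.snocEquiv fun _ : Fin (k + 1) => Fin n).sum_comp, Fintype.sum_prod_type_right]
  refine Finset.sum_congr rfl fun v _ => ?_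
  have hagree : ∀ j : Fin n, ∀ i < k,
      padWord j₀ (Fin.snocEquiv (fun _ : Fin (k + 1) => Fin n) (j, v)) i = padWord j₀ v i := by
    intro j i hi
    have hi' : i < k + 1 := by omega
    simp [padWord, hi, hi', Fin.snocEquiv, Fin.snoc]
  have hlast : ∀ j : Fin n,
      padWord j₀ (Fin.snocEquiv (fun _ : Fin (k + 1) => Fin n) (j, v)) k = j := by
    intro j
    simp [padWord, Fin.snocEquiv, Fin.snoc]
  have hblock : ∀ j : Fin n, ∀ i ≤ k,
      S.block x (padWord j₀ (Fin.snocEquiv (fun _ : Fin (k + 1) => Fin n) (j, v))) i =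
        S.block x (padWord j₀ v) i :=
    fun j i hi => S.block_congr x fun l hl => hagree j l (by omega)
  rw [Finset.mul_sum, Finset.mul_sum]
  refine Finset.sum_congr rfl fun j _ => ?_
  rw [Finset.prod_range_succ, block_succ, hlast, hblock j k le_rfl, hF _ _ (hagree j),
    Finset.prod_congr rfl fun i hi => by
      rw [hagree j i (Finset.mem_range.1 hi), hblock j i (Finset.mem_range.1 hi).le]]
  ring

end PathIntegral

/-! ### Orthogonal differences along the chain -/

section Chain

variable {X : Type*} [MetricSpace X] {m n : ℕ}

/-- `F` is already determined at time `k`, so conditioning on the first `k` letters replaces `h` by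
its `l`-step expectation: the Markov property iterated `l` times. -/
theorem integral_mul_block_add (S : GIFSpdp X m n) (x : Fin m → X) {k : ℕ}
    {F : (ℕ → Fin n) → ℝ} (hF : DependsOnFirst k F) (l : ℕ) (h : C(Fin m → X, ℝ)) :
    ∫ w, F w * h (S.block x w (k + l)) ∂S.pathMeasure x =
      ∫ w, F w * (S.transfer^[l] h) (S.block x w k) ∂S.pathMeasure x := by
  induction l generalizing h with
  | zero => rfl
  | succ l ih =>
    rw [Function.iterate_succ_apply, ← ih, ← add_assoc,
      S.integral_mul_block_succ x (hF.mono (Nat.le_add_right k l))]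
    rfl

variable [CompactSpace X]

theorem norm_transfer_le (S : GIFSpdp X m n) (g : C(Fin m → X, ℝ)) :
    ‖S.transfer g‖ ≤ ‖g‖ := by
  refine (ContinuousMap.norm_le _ (norm_nonneg _)).2 fun x => ?_
  calc ‖∑ j, S.p j x * g (S.ext j x)‖ ≤ ∑ j, S.p j x * ‖g‖ := by
        refine norm_sum_le_of_le _ fun j _ => ?_
        rw [norm_mul, Real.norm_of_nonneg (S.p_mem j x).1]
        exact mul_le_mul_of_nonneg_left (g.norm_coe_le_norm _) (S.p_mem j x).1
    _ = ‖g‖ := by rw [← Finset.sum_mul, S.sum_p, one_mul]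

theorem norm_iterate_transfer_le (S : GIFSpdp X m n) (g : C(Fin m → X, ℝ)) (N : ℕ) :
    ‖S.transfer^[N] g‖ ≤ ‖g‖ := by
  induction N with
  | zero => rfl
  | succ N ih =>
    rw [Function.iterate_succ_apply']
    exact (S.norm_transfer_le _).trans ih

/-- Along almost every path, the averages of `g` minus its conditional expectation given the
block `l` steps earlier tend to zero. -/
theorem ae_tendsto_average_sub_iterate_transfer (S : GIFSpdp X m n) (x : Fin m → X) (l : ℕ)
    (g : C(Fin m → X, ℝ)) :
    ∀ᵐ w ∂S.pathMeasure x, Tendsto (fun N : ℕ => (∑ k ∈ Finset.range N,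
      (g (S.block x w (l * (k + 1))) - (S.transfer^[l] g) (S.block x w (l * k)))) / (N : ℝ))
      atTop (𝓝 0) := by
  have hdep : ∀ k, DependsOnFirst (l * (k + 1)) fun w =>
      g (S.block x w (l * (k + 1))) - (S.transfer^[l] g) (S.block x w (l * k)) := fun k =>
    (S.dependsOnFirst_block x g _).sub ((S.dependsOnFirst_block x (S.transfer^[l] g) _).mono
      (Nat.mul_le_mul_left l k.le_succ))
  refine ae_tendsto_average_of_orthogonal (C := ‖g‖ + ‖g‖) (fun k => (hdep k).measurable)
    (fun k w => ?_) fun i j hij => ?_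
  · exact (abs_sub _ _).trans (add_le_add (g.norm_coe_le_norm _)
      (((S.transfer^[l] g).norm_coe_le_norm _).trans (S.norm_iterate_transfer_le g l)))
  -- As `i < j`, the `i`-th difference is determined by the first `l * j` letters; given these, the
  -- `j`-th difference has mean zero.
  · have hi := (hdep i).mono (Nat.mul_le_mul_left l (Nat.succ_le_of_lt hij))
    simp_rw [mul_sub _ (g (S.block x _ (l * (j + 1))))]
    rw [integral_sub, mul_add l j, mul_one, S.integral_mul_block_add x hi, sub_self]
    · exact ((hi.mono (Nat.mul_le_mul_left l j.le_succ)).mul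
        (S.dependsOnFirst_block x g _)).integrable _
    · exact (hi.mul (S.dependsOnFirst_block x (S.transfer^[l] g) _)).integrable _

end Chain

end GIFSpdp

namespace GIFSpdp

/-! ### A weighted distance contracted by the extension -/

section Gauge

variable {X : Type*} [MetricSpace X] {m n : ℕ}

/-- The maximum distance on `X^m` in which the `i`-th coordinate has the weight `θ ^ i`. -/
noncomputable def weightedDist (θ : ℝ) (x y : Fin m → X) : ℝ :=
  ‖fun i : Fin m => θ ^ (i : ℕ) * dist (x i) (y i)‖

theorem weightedDist_nonneg (θ : ℝ) (x y : Fin m → X) : 0 ≤ weightedDist θ x y :=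
  norm_nonneg _

theorem mul_dist_le_weightedDist (θ : ℝ) (x y : Fin m → X) (i : Fin m) :
    θ ^ (i : ℕ) * dist (x i) (y i) ≤ weightedDist θ x y :=
  (le_abs_self _).trans (norm_le_pi_norm (fun i : Fin m => θ ^ (i : ℕ) * dist (x i) (y i)) i)

theorem weightedDist_le {θ : ℝ} (hθ : 0 ≤ θ) {x y : Fin m → X} {r : ℝ} (hr : 0 ≤ r)
    (h : ∀ i : Fin m, θ ^ (i : ℕ) * dist (x i) (y i) ≤ r) : weightedDist θ x y ≤ r := by
  refine (pi_norm_le_iff_of_nonneg hr).2 fun i => ?_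
  rw [Real.norm_of_nonneg (by positivity)]
  exact h i

theorem dist_apply_le_weightedDist {θ : ℝ} (hθ : 1 ≤ θ) (x y : Fin m → X) (i : Fin m) :
    dist (x i) (y i) ≤ weightedDist θ x y :=
  (le_mul_of_one_le_left dist_nonneg (one_le_pow₀ hθ)).trans
    (mul_dist_le_weightedDist θ x y i)

theorem dist_le_weightedDist {θ : ℝ} (hθ : 1 ≤ θ) (x y : Fin m → X) :
    dist x y ≤ weightedDist θ x y :=
  (dist_pi_le_iff (weightedDist_nonneg θ x y)).2 (dist_apply_le_weightedDist hθ x y)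

theorem weightedDist_le_mul_dist {θ : ℝ} (hθ : 1 ≤ θ) (x y : Fin m → X) :
    weightedDist θ x y ≤ θ ^ m * dist x y := by
  have h0 := zero_le_one.trans hθ
  refine weightedDist_le h0 (by positivity) fun i => ?_
  exact mul_le_mul (pow_le_pow_right₀ hθ i.2.le) (dist_le_pi_dist x y i) dist_nonneg
    (by positivity)

/-- For `θ ≥ 1` every coordinate distance is at most the weighted one, so only the sum of the
coefficients matters. -/
theorem _root_.LipCoeff.dist_le {Y : Type*} [PseudoMetricSpace Y] {a : Fin m → ℝ}
    {f : (Fin m → X) → Y} (hf : LipCoeff a f) {θ : ℝ} (hθ : 1 ≤ θ) (x y : Fin m → X) :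
    dist (f x) (f y) ≤ (∑ i, a i) * weightedDist θ x y := by
  refine (hf.2 x y).trans ?_
  rw [Finset.sum_mul]
  exact Finset.sum_le_sum fun i _ =>
    mul_le_mul_of_nonneg_left (dist_apply_le_weightedDist hθ x y i) (hf.1 i).le

/-- For a weight `θ > 1` close to `1`, all maps of the extension contract the weighted distance
by the factor `θ⁻¹`. -/
theorem E1.exists_weightedDist_ext_le {S : GIFSpdp X m n} (hS : S.E1) :
    ∃ θ : ℝ, 1 < θ ∧ ∀ j x y,
      weightedDist θ (S.ext j x) (S.ext j y) ≤ θ⁻¹ * weightedDist θ x y := by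
  choose a ha ha1 using hS
  -- At `θ = 1` this is the strict bound of E1, so it persists for `θ` slightly larger; finitely
  -- many `j` allow a common `θ`.
  have hlim : ∀ j, ∀ᶠ θ : ℝ in 𝓝[>] 1, θ ^ m * ∑ i, a j i < 1 := by
    intro j
    have hc : Tendsto (fun θ : ℝ => θ ^ m * ∑ i, a j i) (𝓝[>] 1) (𝓝 (1 ^ m * ∑ i, a j i)) :=
      (Continuous.tendsto (by fun_prop) 1).mono_left nhdsWithin_le_nhds
    exact hc.eventually_lt_const (by simpa using ha1 j)
  obtain ⟨θ, hθ, hθ1⟩ :=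
    ((eventually_all.2 hlim).and (eventually_mem_nhdsWithin (a := (1 : ℝ)))).exists
  have hθ1 : 1 < θ := hθ1
  have h0 : 0 < θ := zero_lt_one.trans hθ1
  refine ⟨θ, hθ1, fun j x y => weightedDist_le h0.le
    (mul_nonneg (inv_nonneg.2 h0.le) (weightedDist_nonneg θ x y)) fun i => ?_⟩
  -- After multiplication by `θ`, coordinate `i` carries `θ ^ (i + 1)`: the weight of the coordinate
  -- it is shifted from, or `θ ^ m` for the new coordinate, where the choice of `θ` is used.
  rw [le_inv_mul_iff₀ h0, ← mul_assoc, ← pow_succ']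
  unfold ext
  split_ifs with h
  · exact mul_dist_le_weightedDist θ x y ⟨i + 1, h⟩
  · have hi : (i : ℕ) + 1 = m := by omega
    rw [hi]
    calc θ ^ m * dist (S.φ j x) (S.φ j y)
        ≤ θ ^ m * ((∑ i, a j i) * weightedDist θ x y) :=
          mul_le_mul_of_nonneg_left ((ha j).dist_le hθ1.le x y) (by positivity)
      _ = (θ ^ m * ∑ i, a j i) * weightedDist θ x y := by ring
      _ ≤ 1 * weightedDist θ x y :=
          mul_le_mul_of_nonneg_right (hθ j).le (weightedDist_nonneg θ x y)
      _ = weightedDist θ x y := one_mul _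

theorem E2.abs_sub_le {S : GIFSpdp X m n} (hS : S.E2) {θ : ℝ} (hθ : 1 ≤ θ) (j : Fin n)
    (x y : Fin m → X) : |S.p j x - S.p j y| ≤ weightedDist θ x y := by
  obtain ⟨c, hc, hc1⟩ := hS.2 j
  rw [← Real.dist_eq]
  exact (hc.dist_le hθ x y).trans (mul_le_of_le_one_left (weightedDist_nonneg θ x y) hc1.le)

theorem weightedDist_iterate_ext_le {S : GIFSpdp X m n} {θ : ℝ} (hθ : 1 < θ)
    (hS : ∀ j x y, weightedDist θ (S.ext j x) (S.ext j y) ≤ θ⁻¹ * weightedDist θ x y)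
    (j : Fin n) (M : ℕ) (x y : Fin m → X) :
    weightedDist θ ((S.ext j)^[M] x) ((S.ext j)^[M] y) ≤ θ⁻¹ ^ M * weightedDist θ x y := by
  induction M with
  | zero => simp
  | succ M ih =>
    rw [Function.iterate_succ_apply', Function.iterate_succ_apply', pow_succ', mul_assoc]
    exact (hS j _ _).trans (mul_le_mul_of_nonneg_left ih (by positivity))

end Gauge

/-! ### Uniform convergence of the iterated transfer operator -/

section Transfer

variable {X : Type*} [MetricSpace X] {m n : ℕ}

theorem transfer_mem_Icc (S : GIFSpdp X m n) {g : C(Fin m → X, ℝ)} {a b : ℝ}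
    (hg : ∀ x, g x ∈ Set.Icc a b) (x : Fin m → X) : S.transfer g x ∈ Set.Icc a b := by
  change ∑ j, S.p j x * g (S.ext j x) ∈ _
  constructor
  · calc a = ∑ j, S.p j x * a := by rw [← Finset.sum_mul, S.sum_p, one_mul]
      _ ≤ _ := Finset.sum_le_sum fun j _ =>
        mul_le_mul_of_nonneg_left (hg _).1 (S.p_mem j x).1
  · calc _ ≤ ∑ j, S.p j x * b := Finset.sum_le_sum fun j _ =>
        mul_le_mul_of_nonneg_left (hg _).2 (S.p_mem j x).1
      _ = b := by rw [← Finset.sum_mul, S.sum_p, one_mul]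

theorem iterate_transfer_mem_Icc (S : GIFSpdp X m n) {g : C(Fin m → X, ℝ)} {a b : ℝ}
    (hg : ∀ x, g x ∈ Set.Icc a b) (N : ℕ) (x : Fin m → X) :
    (S.transfer^[N] g) x ∈ Set.Icc a b := by
  induction N generalizing x with
  | zero => exact hg x
  | succ N ih =>
    rw [Function.iterate_succ_apply']
    exact S.transfer_mem_Icc ih x

/-- One step of the transfer operator splits off the mass `δ` on the map `ext j₀`. -/
theorem transfer_sub_le (S : GIFSpdp X m n) {δ : ℝ} {j₀ : Fin n} (hδ : ∀ x, δ ≤ S.p j₀ x)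
    {g : C(Fin m → X, ℝ)} {a b : ℝ} (hg : ∀ x, g x ∈ Set.Icc a b) (x y : Fin m → X) :
    S.transfer g x - S.transfer g y ≤
      δ * (g (S.ext j₀ x) - g (S.ext j₀ y)) + (1 - δ) * (b - a) := by
  -- The remaining weights are nonnegative with sum `1 - δ`; for them only the range `[a, b]` of `g`
  -- is used.
  have hsplit : ∀ z, S.transfer g z = δ * g (S.ext j₀ z) +
      ∑ j, (S.p j z - if j = j₀ then δ else 0) * g (S.ext j z) := by
    intro z
    simp_rw [sub_mul, Finset.sum_sub_distrib, ite_mul, zero_mul, Finset.sum_ite_eq',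
      Finset.mem_univ, if_true, add_sub_cancel]
    rfl
  have hw : ∀ z j, 0 ≤ S.p j z - if j = j₀ then δ else 0 := by
    intro z j
    split_ifs with h
    · rw [h]
      exact sub_nonneg.2 (hδ z)
    · simpa using (S.p_mem j z).1
  have hsum : ∀ z c, ∑ j, (S.p j z - if j = j₀ then δ else 0) * c = (1 - δ) * c := by
    intro z c
    rw [← Finset.sum_mul, Finset.sum_sub_distrib, S.sum_p]
    simp
  have hx := Finset.sum_le_sum fun j (_ : j ∈ Finset.univ) =>
    mul_le_mul_of_nonneg_left (hg (S.ext j x)).2 (hw x j)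
  have hy := Finset.sum_le_sum fun j (_ : j ∈ Finset.univ) =>
    mul_le_mul_of_nonneg_left (hg (S.ext j y)).1 (hw y j)
  rw [hsum] at hx hy
  rw [hsplit x, hsplit y]
  linarith

/-- Choosing `j₀` at all `M` steps carries mass at least `δ ^ M`. Along that word the two points can
be compared; the rest of the mass contributes at most `b - a`, because the iterates keep the range
of `g`. -/
theorem iterate_transfer_sub_le (S : GIFSpdp X m n) {δ : ℝ} (hδ0 : 0 ≤ δ) {j₀ : Fin n}
    (hδ : ∀ x, δ ≤ S.p j₀ x) {g : C(Fin m → X, ℝ)} {a b : ℝ} (hg : ∀ x, g x ∈ Set.Icc a b)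
    (M : ℕ) (x y : Fin m → X) :
    (S.transfer^[M] g) x - (S.transfer^[M] g) y ≤
      δ ^ M * (g ((S.ext j₀)^[M] x) - g ((S.ext j₀)^[M] y)) + (1 - δ ^ M) * (b - a) := by
  induction M generalizing x y with
  | zero => simp
  | succ M ih =>
    rw [Function.iterate_succ_apply', Function.iterate_succ_apply, Function.iterate_succ_apply]
    have h1 := S.transfer_sub_le hδ (S.iterate_transfer_mem_Icc hg M) x y
    have h2 := mul_le_mul_of_nonneg_left (ih (S.ext j₀ x) (S.ext j₀ y)) hδ0
    rw [pow_succ']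
    linarith

/-- An approximate Lipschitz bound of a function is improved by the transfer operator, up to a
term controlled by its size. -/
theorem E2.transfer_sub_le {S : GIFSpdp X m n} (hS : S.E2) {θ : ℝ} (hθ : 1 < θ)
    (hext : ∀ j x y, weightedDist θ (S.ext j x) (S.ext j y) ≤ θ⁻¹ * weightedDist θ x y)
    {g : C(Fin m → X, ℝ)} {η K G : ℝ} (hK : 0 ≤ K) (hG : ∀ x, |g x| ≤ G)
    (hg : ∀ x y, g x - g y ≤ η + K * weightedDist θ x y) (x y : Fin m → X) :
    S.transfer g x - S.transfer g y ≤ η + (θ⁻¹ * K + n * G) * weightedDist θ x y := by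
  -- The first sum moves the point with the weights fixed and gains `θ⁻¹`; the second moves the
  -- weights and costs `n * G`.
  have e : S.transfer g x - S.transfer g y =
      ∑ j, S.p j x * (g (S.ext j x) - g (S.ext j y)) +
        ∑ j, (S.p j x - S.p j y) * g (S.ext j y) := by
    rw [← Finset.sum_add_distrib]
    change ∑ j, S.p j x * g (S.ext j x) - ∑ j, S.p j y * g (S.ext j y) = _
    rw [← Finset.sum_sub_distrib]
    exact Finset.sum_congr rfl fun j _ => by ring
  have h1 : ∑ j, S.p j x * (g (S.ext j x) - g (S.ext j y)) ≤
      η + K * (θ⁻¹ * weightedDist θ x y) := by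
    calc _ ≤ ∑ j, S.p j x * (η + K * (θ⁻¹ * weightedDist θ x y)) :=
          Finset.sum_le_sum fun j _ => mul_le_mul_of_nonneg_left ((hg _ _).trans
            (add_le_add_right (mul_le_mul_of_nonneg_left (hext j x y) hK) _)) (S.p_mem j x).1
      _ = _ := by rw [← Finset.sum_mul, S.sum_p, one_mul]
  have h2 : ∑ j, (S.p j x - S.p j y) * g (S.ext j y) ≤ n * (weightedDist θ x y * G) := by
    calc _ ≤ ∑ _j : Fin n, weightedDist θ x y * G := Finset.sum_le_sum fun j _ => by
          refine (le_abs_self _).trans ?_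
          rw [abs_mul]
          exact mul_le_mul (hS.abs_sub_le hθ.le j x y) (hG _) (abs_nonneg _)
            (weightedDist_nonneg θ x y)
      _ = _ := by simp
  rw [e]
  linarith

variable [CompactSpace X]

/-- A continuous function on `X^m` is Lipschitz up to an arbitrarily small additive error. -/
theorem exists_sub_le_add_mul_weightedDist {θ : ℝ} (hθ : 1 ≤ θ) (g : C(Fin m → X, ℝ)) {η : ℝ}
    (hη : 0 < η) :
    ∃ K : ℝ, ∀ x y, g x - g y ≤ η + K * weightedDist θ x y := by
  obtain ⟨τ, hτ, h⟩ := Metric.uniformContinuous_iff.1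
    (CompactSpace.uniformContinuous_of_continuous g.continuous) η hη
  -- Points closer than `τ` are handled by uniform continuity; for the others the trivial bound `2 *
  -- ‖g‖` is at most `K` times the distance.
  refine ⟨2 * ‖g‖ / τ, fun x y => ?_⟩
  have hnn : 0 ≤ 2 * ‖g‖ / τ := by positivity
  rcases lt_or_ge (dist x y) τ with hxy | hxy
  · have h1 := h hxy
    rw [Real.dist_eq] at h1
    have h2 := mul_nonneg hnn (weightedDist_nonneg θ x y)
    linarith [le_abs_self (g x - g y)]
  · have h1 : 2 * ‖g‖ ≤ 2 * ‖g‖ / τ * weightedDist θ x y := by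
      rw [div_mul_eq_mul_div, le_div_iff₀ hτ]
      exact mul_le_mul_of_nonneg_left (hxy.trans (dist_le_weightedDist hθ x y)) (by positivity)
    have h2 := abs_le.1 (g.norm_coe_le_norm x)
    have h3 := abs_le.1 (g.norm_coe_le_norm y)
    linarith [h2.2, h3.1]

/-- The iterates of the transfer operator on a continuous function share an approximate Lipschitz
bound. -/
theorem E2.exists_iterate_transfer_sub_le {S : GIFSpdp X m n} (hS : S.E2) {θ : ℝ} (hθ : 1 < θ)
    (hext : ∀ j x y, weightedDist θ (S.ext j x) (S.ext j y) ≤ θ⁻¹ * weightedDist θ x y)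
    (g : C(Fin m → X, ℝ)) {η : ℝ} (hη : 0 < η) :
    ∃ K : ℝ, 0 ≤ K ∧ ∀ N x y,
      (S.transfer^[N] g) x - (S.transfer^[N] g) y ≤ η + K * weightedDist θ x y := by
  obtain ⟨L, hL⟩ := exists_sub_le_add_mul_weightedDist hθ.le g hη
  have hθ' : 0 < 1 - θ⁻¹ := sub_pos.2 (inv_lt_one_of_one_lt₀ hθ)
  have hK0 : 0 ≤ n * ‖g‖ / (1 - θ⁻¹) := by positivity
  -- Any `K ≥ n * ‖g‖ / (1 - θ⁻¹)` satisfies `θ⁻¹ * K + n * ‖g‖ ≤ K`, so the bound reproduces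
  -- itself; `L` covers `N = 0`.
  refine ⟨max L (n * ‖g‖ / (1 - θ⁻¹)), hK0.trans (le_max_right _ _), fun N => ?_⟩
  induction N with
  | zero =>
    intro x y
    exact (hL x y).trans (add_le_add_right
      (mul_le_mul_of_nonneg_right (le_max_left _ _) (weightedDist_nonneg θ x y)) _)
  | succ N ih =>
    intro x y
    rw [Function.iterate_succ_apply']
    refine (hS.transfer_sub_le hθ hext (hK0.trans (le_max_right _ _)) (fun z =>
      ((S.transfer^[N] g).norm_coe_le_norm z).trans (S.norm_iterate_transfer_le g N)) ih x y).trans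
      (add_le_add_right (mul_le_mul_of_nonneg_right ?_ (weightedDist_nonneg θ x y)) _)
    have h := (div_le_iff₀ hθ').1 (le_max_right L (n * ‖g‖ / (1 - θ⁻¹)))
    linarith

/-- Under E1 and E2 the iterates of the transfer operator on a continuous function converge
uniformly to a constant. -/
theorem exists_tendsto_iterate_transfer [Nonempty X] {S : GIFSpdp X m n} (hE1 : S.E1)
    (hE2 : S.E2) (g : C(Fin m → X, ℝ)) :
    ∃ c : ℝ, ∀ ε > 0, ∀ᶠ N in atTop, ∀ x, |(S.transfer^[N] g) x - c| ≤ ε := by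
  obtain ⟨θ, hθ, hext⟩ := hE1.exists_weightedDist_ext_le
  obtain ⟨δ, hδ0, hδ⟩ := hE2.1
  have x₀ : Fin m → X := Classical.arbitrary _
  obtain ⟨j₀⟩ : Nonempty (Fin n) := by
    by_contra hn
    rw [not_nonempty_iff] at hn
    simpa using S.sum_p x₀
  set u := fun N => S.transfer^[N] g with hu
  have hbdd : ∀ N, BddAbove (Set.range (u N)) := fun N => (isCompact_range (u N).continuous).bddAbove
  have hbdd' : ∀ N, BddBelow (Set.range (u N)) := fun N =>
    (isCompact_range (u N).continuous).bddBelow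
  set hi := fun N => ⨆ x, u N x with hhi
  set lo := fun N => ⨅ x, u N x with hlo
  have hmem : ∀ N x, u N x ∈ Set.Icc (lo N) (hi N) := fun N x =>
    ⟨ciInf_le (hbdd' N) x, le_ciSup (hbdd N) x⟩
  have hadd : ∀ N M, u (N + M) = S.transfer^[M] (u N) := fun N M => by
    rw [hu, add_comm]
    exact Function.iterate_add_apply _ _ _ _
  have hmemadd : ∀ N M x, u (N + M) x ∈ Set.Icc (lo N) (hi N) := fun N M x => by
    rw [hadd]
    exact S.iterate_transfer_mem_Icc (hmem N) M x
  have hanti : Antitone hi := antitone_nat_of_succ_le fun N => ciSup_le fun x => (hmemadd N 1 x).2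
  have hmono : Monotone lo := monotone_nat_of_le_succ fun N => le_ciInf fun x => (hmemadd N 1 x).1
  have hle : ∀ N M, lo N ≤ hi M := fun N M =>
    (hmono (le_max_left N M)).trans (((hmem _ x₀).1.trans (hmem _ x₀).2).trans
      (hanti (le_max_right N M)))
  have hhilim := tendsto_atTop_ciInf hanti ⟨lo 0, Set.forall_mem_range.2 fun M => hle 0 M⟩
  have hlolim := tendsto_atTop_ciSup hmono ⟨hi 0, Set.forall_mem_range.2 fun M => hle M 0⟩
  set H := ⨅ N, hi N
  set l := ⨆ N, lo N
  obtain ⟨R, hR0, hR⟩ : ∃ R : ℝ, 0 ≤ R ∧ ∀ x y : Fin m → X, weightedDist θ x y ≤ R :=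
    ⟨θ ^ m * Metric.diam (Set.univ : Set (Fin m → X)), by positivity, fun x y =>
      (weightedDist_le_mul_dist hθ.le x y).trans (mul_le_mul_of_nonneg_left
        (Metric.dist_le_diam_of_mem isCompact_univ.isBounded trivial trivial) (by positivity))⟩
  -- `K` depends on `η` but not on `N` or `M`. For fixed `M`, letting `N → ∞` turns both
  -- oscillations into `H - l`, and the factor `δ ^ M` cancels; then `M → ∞`, and finally `η → 0`.
  have hosc : H - l ≤ 0 := by
    refine le_of_forall_pos_le_add fun η hη => ?_
    obtain ⟨K, hK0, hK⟩ := hE2.exists_iterate_transfer_sub_le hθ hext g hη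
    have hM : ∀ M : ℕ, H - l ≤ η + K * (θ⁻¹ ^ M * R) := by
      intro M
      have hN : ∀ N, hi (N + M) - lo (N + M) ≤
          δ ^ M * (η + K * (θ⁻¹ ^ M * R)) + (1 - δ ^ M) * (hi N - lo N) := by
        intro N
        have hxy : ∀ x y, u (N + M) x ≤ u (N + M) y +
            (δ ^ M * (η + K * (θ⁻¹ ^ M * R)) + (1 - δ ^ M) * (hi N - lo N)) := by
          intro x y
          have h1 := S.iterate_transfer_sub_le hδ0.le (hδ j₀) (hmem N) M x y
          rw [← hadd] at h1
          have h2 : u N ((S.ext j₀)^[M] x) - u N ((S.ext j₀)^[M] y) ≤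
              η + K * (θ⁻¹ ^ M * R) := by
            refine (hK N _ _).trans (add_le_add_right (mul_le_mul_of_nonneg_left ?_ hK0) _)
            exact (weightedDist_iterate_ext_le hθ hext j₀ M x y).trans
              (mul_le_mul_of_nonneg_left (hR x y) (by positivity))
          have h3 := mul_le_mul_of_nonneg_left h2 (pow_nonneg hδ0.le M)
          linarith
        have h4 : ∀ y, hi (N + M) - (δ ^ M * (η + K * (θ⁻¹ ^ M * R)) +
            (1 - δ ^ M) * (hi N - lo N)) ≤ u (N + M) y := fun y => by
          rw [sub_le_iff_le_add]
          exact ciSup_le fun x => hxy x y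
        have h5 := le_ciInf h4
        change _ ≤ lo (N + M) at h5
        linarith
      have hlim1 := (hhilim.sub hlolim).comp (tendsto_add_atTop_nat M)
      have hlim2 := ((hhilim.sub hlolim).const_mul (1 - δ ^ M)).const_add
        (δ ^ M * (η + K * (θ⁻¹ ^ M * R)))
      have h6 := le_of_tendsto_of_tendsto' hlim1 hlim2 hN
      have h7 : δ ^ M * (H - l) ≤ δ ^ M * (η + K * (θ⁻¹ ^ M * R)) := by linarith
      exact le_of_mul_le_mul_left h7 (pow_pos hδ0 M)
    have hpow : Tendsto (fun M : ℕ => η + K * (θ⁻¹ ^ M * R)) atTop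
        (𝓝 (η + K * (0 * R))) :=
      (((tendsto_pow_atTop_nhds_zero_of_lt_one (by positivity)
        (inv_lt_one_of_one_lt₀ hθ)).mul_const R).const_mul K).const_add η
    have := ge_of_tendsto' hpow hM
    simpa using this
  have hHl : H ≤ l := sub_nonpos.1 hosc
  refine ⟨l, fun ε hε => ?_⟩
  filter_upwards [hhilim.eventually_lt_const (show H < l + ε by linarith),
    hlolim.eventually_const_lt (show l - ε < l by linarith)] with N h1 h2 x
  rw [abs_le]
  constructor <;> linarith [(hmem N x).1, (hmem N x).2]

end Transfer

end GIFSpdp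

/-! ### Deterministic lemmas on averages -/

/-- If the averages of `u_r(k + 1) - u_{r+1}(k)` tend to zero for every `r` and the bounded
sequences `u_r` are uniformly close to `c` for large `r`, then the averages of `u_0` tend to `c`. -/
theorem tendsto_average_of_telescoping {u : ℕ → ℕ → ℝ} {C c : ℝ} (hC : ∀ r k, |u r k| ≤ C)
    (hstep : ∀ r, Tendsto (fun N : ℕ => (∑ k ∈ Finset.range N, (u r (k + 1) - u (r + 1) k)) /
      (N : ℝ)) atTop (𝓝 0))
    (hlim : ∀ ε > 0, ∃ r, ∀ k, |u r k - c| ≤ ε) :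
    Tendsto (fun N : ℕ => (∑ k ∈ Finset.range N, u 0 k) / (N : ℝ)) atTop (𝓝 c) := by
  have hshift : ∀ r, Tendsto (fun N : ℕ => (∑ k ∈ Finset.range N, (u r (k + 1) - u r k)) /
      (N : ℝ)) atTop (𝓝 0) := by
    intro r
    simp_rw [Finset.sum_range_sub]
    refine squeeze_zero_norm (fun N => ?_) (tendsto_const_div_atTop_nhds_zero_nat (C + C))
    rw [norm_div, Real.norm_natCast, Real.norm_eq_abs]
    exact div_le_div_of_nonneg_right ((abs_sub _ _).trans (add_le_add (hC _ _) (hC _ _)))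
      N.cast_nonneg
  have hdiff : ∀ r, Tendsto (fun N : ℕ => (∑ k ∈ Finset.range N, (u 0 k - u r k)) /
      (N : ℝ)) atTop (𝓝 0) := by
    intro r
    induction r with
    | zero => simp
    | succ r ih =>
      -- `u 0 k - u (r+1) k` equals `(u 0 k - u r k) + (u r (k+1) - u (r+1) k) - (u r (k+1) - u r
      -- k)`.
      have h := (ih.add (hstep r)).sub (hshift r)
      rw [add_zero, sub_zero] at h
      refine h.congr fun N => ?_
      rw [← add_div, ← sub_div, ← Finset.sum_add_distrib, ← Finset.sum_sub_distrib]
      exact congrArg (· / (N : ℝ)) (Finset.sum_congr rfl fun k _ => by ring)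
  rw [Metric.tendsto_nhds]
  intro ε hε
  obtain ⟨r, hr⟩ := hlim (ε / 2) (half_pos hε)
  filter_upwards [(Metric.tendsto_nhds.1 (hdiff r)) (ε / 2) (half_pos hε),
    eventually_ge_atTop 1] with N hN hN1
  have hpos : (0 : ℝ) < N := by exact_mod_cast hN1
  have e : (∑ k ∈ Finset.range N, u 0 k) / (N : ℝ) - c =
      (∑ k ∈ Finset.range N, (u 0 k - u r k)) / (N : ℝ) +
        (∑ k ∈ Finset.range N, (u r k - c)) / (N : ℝ) := by
    rw [← add_div, ← Finset.sum_add_distrib]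
    simp_rw [sub_add_sub_cancel]
    rw [Finset.sum_sub_distrib, Finset.sum_const, Finset.card_range, nsmul_eq_mul]
    field_simp
  have h2 : |(∑ k ∈ Finset.range N, (u r k - c)) / (N : ℝ)| ≤ ε / 2 := by
    rw [abs_div, Nat.abs_cast, div_le_iff₀ hpos]
    calc _ ≤ ∑ _k ∈ Finset.range N, ε / 2 :=
          (Finset.abs_sum_le_sum_abs _ _).trans (Finset.sum_le_sum fun k _ => hr k)
      _ = ε / 2 * N := by simp [mul_comm]
  rw [Real.dist_eq, sub_zero] at hN
  rw [Real.dist_eq, e]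
  exact (abs_add_le _ _).trans_lt (by linarith)

/-- Convergence of averages to an integral passes from a dense set of continuous functions to all
of them. -/
theorem tendsto_average_of_dense {Y : Type*} [TopologicalSpace Y] [CompactSpace Y]
    [MeasurableSpace Y] [BorelSpace Y] (α : ProbabilityMeasure Y) (z : ℕ → Y)
    {s : Set C(Y, ℝ)} (hs : Dense s)
    (h : ∀ g ∈ s, Tendsto (fun N : ℕ => (∑ k ∈ Finset.range N, g (z k)) / (N : ℝ)) atTop
      (𝓝 (∫ y, g y ∂(α : Measure Y)))) (g : C(Y, ℝ)) :
    Tendsto (fun N : ℕ => (∑ k ∈ Finset.range N, g (z k)) / (N : ℝ)) atTop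
      (𝓝 (∫ y, g y ∂(α : Measure Y))) := by
  have hint : ∀ f : C(Y, ℝ), Integrable f (α : Measure Y) := fun f =>
    f.continuous.integrable_of_hasCompactSupport (HasCompactSupport.of_compactSpace f)
  rw [Metric.tendsto_nhds]
  intro ε hε
  obtain ⟨f, hfs, hf⟩ := Metric.mem_closure_iff.1 (hs g) (ε / 3) (by positivity)
  rw [dist_eq_norm] at hf
  filter_upwards [Metric.tendsto_nhds.1 (h f hfs) (ε / 3) (by positivity),
    eventually_ge_atTop 1] with N hN hN1
  have hpos : (0 : ℝ) < N := by exact_mod_cast hN1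
  have h1 : |(∑ k ∈ Finset.range N, g (z k)) / (N : ℝ) -
      (∑ k ∈ Finset.range N, f (z k)) / (N : ℝ)| ≤ ‖g - f‖ := by
    rw [← sub_div, ← Finset.sum_sub_distrib, abs_div, Nat.abs_cast, div_le_iff₀ hpos]
    calc _ ≤ ∑ _k ∈ Finset.range N, ‖g - f‖ := (Finset.abs_sum_le_sum_abs _ _).trans
          (Finset.sum_le_sum fun k _ => (g - f).norm_coe_le_norm (z k))
      _ = ‖g - f‖ * N := by simp [mul_comm]
  have h2 : |∫ y, g y ∂(α : Measure Y) - ∫ y, f y ∂(α : Measure Y)| ≤ ‖g - f‖ := by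
    rw [← integral_sub (hint g) (hint f)]
    have := norm_integral_le_of_norm_le_const (μ := (α : Measure Y)) (f := fun y => g y - f y)
      (C := ‖g - f‖) (ae_of_all _ fun y => (g - f).norm_coe_le_norm y)
    simpa using this
  rw [Real.dist_eq] at hN ⊢
  rw [abs_lt] at hN ⊢
  rw [abs_le] at h1 h2
  constructor <;> linarith [hN.1, hN.2, h1.1, h1.2, h2.1, h2.2]

/-! ### Existence and uniqueness of the extended Hutchinson measure -/

namespace GIFSpdp

section Hutchinson

variable {X : Type*} [MetricSpace X] [CompactSpace X] [MeasurableSpace X] [BorelSpace X]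
  {m n : ℕ}

theorem integral_iterate_markov (S : GIFSpdp X m n) (α : ProbabilityMeasure (Fin m → X)) (N : ℕ)
    (g : C(Fin m → X, ℝ)) :
    ∫ x, g x ∂(S.markov^[N] α : Measure (Fin m → X)) =
      ∫ x, (S.transfer^[N] g) x ∂(α : Measure (Fin m → X)) := by
  induction N generalizing g with
  | zero => rfl
  | succ N ih => rw [Function.iterate_succ_apply', integral_markov, ih, Function.iterate_succ_apply]

theorem _root_.MeasureTheory.ProbabilityMeasure.ext_of_forall_integral_continuousMap
    {Y : Type*} [MetricSpace Y] [MeasurableSpace Y] [BorelSpace Y] {α β : ProbabilityMeasure Y}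
    (h : ∀ g : C(Y, ℝ), ∫ y, g y ∂(α : Measure Y) = ∫ y, g y ∂(β : Measure Y)) : α = β := by
  refine Subtype.ext ?_
  change (α : Measure Y) = (β : Measure Y)
  exact ext_of_forall_integral_eq_of_IsFiniteMeasure fun f => h f.toContinuousMap

/-- The limit does not depend on `α`. This identifies the limit of an orbit of `markov` and also the
integrals against any fixed point. -/
theorem tendsto_integral_iterate_transfer {S : GIFSpdp X m n} {g : C(Fin m → X, ℝ)} {c : ℝ}
    (hc : ∀ ε > 0, ∀ᶠ N in atTop, ∀ x, |(S.transfer^[N] g) x - c| ≤ ε)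
    (α : ProbabilityMeasure (Fin m → X)) :
    Tendsto (fun N => ∫ x, (S.transfer^[N] g) x ∂(α : Measure (Fin m → X))) atTop (𝓝 c) := by
  rw [Metric.tendsto_nhds]
  intro ε hε
  filter_upwards [hc (ε / 2) (half_pos hε)] with N hN
  have hint : Integrable (S.transfer^[N] g) (α : Measure (Fin m → X)) :=
    (S.transfer^[N] g).continuous.integrable_of_hasCompactSupport
      (HasCompactSupport.of_compactSpace _)
  have h := norm_integral_le_of_norm_le_const (μ := (α : Measure (Fin m → X)))
    (f := fun x => (S.transfer^[N] g) x - c) (ae_of_all _ hN)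
  rw [integral_sub hint (integrable_const c)] at h
  simp only [integral_const, probReal_univ, one_smul, mul_one] at h
  rw [Real.dist_eq]
  exact h.trans_lt (half_lt_self hε)

/-- Under E1 and E2 there is a unique extended Hutchinson measure, and the iterates of the
transfer operator converge uniformly to the integral against it. -/
theorem exists_isExtendedHutchinson [Nonempty X] {S : GIFSpdp X m n} (hE1 : S.E1)
    (hE2 : S.E2) :
    ∃ α : ProbabilityMeasure (Fin m → X), S.IsExtendedHutchinson α ∧
      ∀ g : C(Fin m → X, ℝ), ∀ ε > 0, ∀ᶠ N in atTop, ∀ x,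
        |(S.transfer^[N] g) x - ∫ y, g y ∂(α : Measure (Fin m → X))| ≤ ε := by
  choose c hc using fun g => exists_tendsto_iterate_transfer hE1 hE2 g
  have ν : ProbabilityMeasure (Fin m → X) :=
    ⟨Measure.dirac (Classical.arbitrary _), Measure.dirac.isProbabilityMeasure⟩
  -- By compactness the orbit of an arbitrary `ν` converges along a free ultrafilter, so no
  -- subsequence has to be extracted.
  set F : Ultrafilter (ProbabilityMeasure (Fin m → X)) :=
    (hyperfilter ℕ).map fun N => S.markov^[N] ν
  have hF : Tendsto (fun N => S.markov^[N] ν) (hyperfilter ℕ : Filter ℕ) (𝓝 F.lim) := F.le_nhds_lim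
  have hα : ∀ g : C(Fin m → X, ℝ), ∫ y, g y ∂(F.lim : Measure (Fin m → X)) = c g := by
    intro g
    have h1 := (ProbabilityMeasure.tendsto_iff_forall_integral_tendsto.1 hF)
      (BoundedContinuousFunction.mkOfCompact g)
    simp only [BoundedContinuousFunction.mkOfCompact_apply, integral_iterate_markov] at h1
    exact tendsto_nhds_unique h1
      ((tendsto_integral_iterate_transfer (hc g) ν).mono_left Nat.hyperfilter_le_atTop)
  have hfix : ∀ β : ProbabilityMeasure (Fin m → X), S.markov β = β →
      ∀ g : C(Fin m → X, ℝ), ∫ y, g y ∂(β : Measure (Fin m → X)) = c g := by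
    intro β hβ g
    have h := tendsto_integral_iterate_transfer (hc g) β
    simp_rw [← integral_iterate_markov, Function.iterate_fixed hβ] at h
    exact tendsto_nhds_unique tendsto_const_nhds h
  -- The iterates of `transfer g` are those of `g` shifted by one; by duality this makes the limit
  -- measure a fixed point.
  have hcT : ∀ g, c (S.transfer g) = c g := by
    intro g
    have h := (tendsto_integral_iterate_transfer (hc g) ν).comp (tendsto_add_atTop_nat 1)
    exact tendsto_nhds_unique (tendsto_integral_iterate_transfer (hc (S.transfer g)) ν) h
  refine ⟨F.lim, ⟨?_, fun β hβ => ?_⟩, fun g => ?_⟩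
  · refine ProbabilityMeasure.ext_of_forall_integral_continuousMap fun g => ?_
    rw [integral_markov, hα, hα, hcT]
  · exact ProbabilityMeasure.ext_of_forall_integral_continuousMap fun g => by
      rw [hfix β hβ, hα]
  · rw [hα]
    exact hc g

end Hutchinson

end GIFSpdp

/-! ### The ergodic theorem -/

theorem mainTheorem2 {X : Type*} [MetricSpace X] [CompactSpace X] [Nonempty X]
    [MeasurableSpace X] [BorelSpace X] {m n : ℕ} (hm : 1 ≤ m)
    (S : GIFSpdp X m n) (hE1 : S.E1) (hE2 : S.E2) :
    ∃ α : ProbabilityMeasure (Fin m → X), S.IsExtendedHutchinson α ∧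
      ∀ x : Fin m → X, ∃ Ωx : Set (ℕ → Fin n),
        MeasurableSet Ωx ∧ S.pathMeasure x Ωx = 1 ∧
        ∀ w ∈ Ωx, ∀ g : C(Fin m → X, ℝ),
          Tendsto
            (fun N : ℕ => (1 / (N : ℝ)) *
              ∑ k ∈ Finset.range N, g (fun i : Fin m => S.orbit x w (m * k + i)))
            atTop (𝓝 (∫ y, g y ∂(α : Measure (Fin m → X)))) := by
  obtain ⟨α, hα, hlim⟩ := GIFSpdp.exists_isExtendedHutchinson hE1 hE2
  refine ⟨α, hα, fun x => ?_⟩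
  obtain ⟨s, hs, hdense⟩ := TopologicalSpace.exists_countable_dense C(Fin m → X, ℝ)
  have hae : ∀ᵐ w ∂S.pathMeasure x, ∀ g ∈ s,
      Tendsto (fun N : ℕ => (∑ k ∈ Finset.range N, g (S.block x w (m * k))) / (N : ℝ)) atTop
        (𝓝 (∫ y, g y ∂(α : Measure (Fin m → X)))) := by
    refine (ae_ball_iff hs).2 fun g _ => ?_
    -- The strong law with step `m` is used for all `r` at once, over a countable union of null
    -- sets.
    filter_upwards [ae_all_iff.2 fun r =>
      S.ae_tendsto_average_sub_iterate_transfer x m (S.transfer^[m * r] g)] with w hw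
    refine tendsto_average_of_telescoping
      (u := fun r k => (S.transfer^[m * r] g) (S.block x w (m * k))) (C := ‖g‖)
      (fun r k => ((S.transfer^[m * r] g).norm_coe_le_norm _).trans
        (S.norm_iterate_transfer_le g _)) (fun r => ?_) fun ε hε => ?_
    · simp_rw [mul_add m r, mul_one, add_comm (m * r) m, Function.iterate_add_apply]
      exact hw r
    · obtain ⟨N, hN⟩ := eventually_atTop.1 (hlim g ε hε)
      -- Since `m ≥ 1`, the exponent `m * N` is at least `N`; uniformity in the point covers all
      -- blocks.
      exact ⟨N, fun k => hN (m * N) (Nat.le_mul_of_pos_left N hm) _⟩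
  obtain ⟨Ωx, hfull, hmeas, hΩx⟩ := hae.exists_measurable_mem
  refine ⟨Ωx, hmeas, (mem_ae_iff_prob_eq_one hmeas).1 hfull, fun w hw g => ?_⟩
  simp_rw [one_div_mul_eq_div]
  exact tendsto_average_of_dense α (fun k => S.block x w (m * k)) hdense (hΩx w hw) g
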